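/- Let $d\ge 1$, let $\mathbb H_d$ be the space of Hermitian $d\times d$ matrices, let $\rho\in\mathbb H_d$ be a quantum state ($\rho\succeq 0$, $\operatorname{tr}\rho=1$), and let $\mathrm dv$ be the unitarily invariant probability measure on the unit sphere $\mathbb S^d$ of $\mathbb C^d$. Measuring the uniform POVM $\{d\,|v\rangle\langle v|\,\mathrm dv\}_{v\in\mathbb S^d}$ on $\rho$ yields a random outcome $v\in\mathbb S^d$ with law $d\,\langle v|\rho|v\rangle\,\mathrm dv$. For outcomes $v_1,\dots,v_n$ ($n\ge1$), a least-squares estimator is a minimizer over $X\in\mathbb H_d$ of $$\int_{\mathbb S^d}\bigl(d\,\langle v|X|v\rangle\bigr)^2\,\mathrm dv-\frac2n\sum_{i=1}^n d\,\langle v_i|X|v_i\rangle ,$$ i.e. of $\int (f_n(v)-d\langle v|X|v\rangle)^2\,\mathrm dv$ for the empirical distribution $f_n=\frac1n\sum_i\delta_{v_i}$, with the $X$-independent term $\int f_n^2$ left out. For all $v_1,\dots,v_n\in\mathbb S^d$ there is exactly one least-squares estimator, denoted $\hat L_n$. **Theorem.** Let $v_1,\dots,v_n$ be the outcomes of $n\ge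 1$ independent uniform POVM measurements on $\rho$, and let $\|\cdot\|_\infty$ denote the operator norm. Then for every $\tau\in[0,1]$, $$\Pr\bigl[\|\hat L_n-\rho\|_\infty\ge\tau\bigr]\le 2\exp\bigl(c_1 d-c_2 n\tau^2\bigr),\qquad c_1=2\log 3,\quad c_2=\tfrac1{480}.$$ In particular, for every $\delta_0\in(0,1)$ there is a constant $C>0$, depending only on $\delta_0$ (so an absolute constant if, say, $\delta_0=\frac12$), such that for all $d$, $\rho$, all $\tau\in(0,1]$ and all $\delta\in(0,\delta_0]$, the condition $$n\ge C\,\frac{d}{\tau^2}\,\log(1/\delta)$$ implies $\|\hat L_n-\rho\|_\infty\le\tau$ with probability at least $1-\delta$. -/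

import Mathlib

open MeasureTheory ProbabilityTheory Set
open scoped ComplexOrder

noncomputable section

/-- The complex unit sphere of `ℂ^d`, whose points index the outcomes of the uniform POVM. -/
abbrev ComplexSphere (d : ℕ) : Type :=
  Metric.sphere (0 : EuclideanSpace ℂ (Fin d)) 1

/-- A quantum state (density matrix): positive semidefinite with unit trace. -/
def IsQuantumState {d : ℕ} (ρ : Matrix (Fin d) (Fin d) ℂ) : Prop :=
  ρ.PosSemidef ∧ ρ.trace = 1

/-- The operator norm `‖A‖_∞` of a matrix acting on `ℂ^d` with its Euclidean norm. -/
def opNorm {d : ℕ} (A : Matrix (Fin d) (Fin d) ℂ) : ℝ :=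
  ‖Matrix.toEuclideanCLM (n := Fin d) (𝕜 := ℂ) A‖

/-- The unitarily invariant probability measure `dv` on the complex unit sphere: the surface
measure induced by Lebesgue measure on `ℂ^d`, normalized to total mass one. -/
def uniformSphere (d : ℕ) : Measure (ComplexSphere d) :=
  ((volume : Measure (EuclideanSpace ℂ (Fin d))).toSphere univ)⁻¹ •
    (volume : Measure (EuclideanSpace ℂ (Fin d))).toSphere

/-- The measurement map of the uniform POVM `{d |v⟩⟨v| dv}`: the density
`tr(d |v⟩⟨v| X) = d ⟨v|X|v⟩` with respect to `dv`, which is real for Hermitian `X`. -/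
def uniformPOVM {d : ℕ} (X : Matrix (Fin d) (Fin d) ℂ) (v : ComplexSphere d) : ℝ :=
  d * (inner ℂ (v : EuclideanSpace ℂ (Fin d))
    (Matrix.toEuclideanCLM (n := Fin d) (𝕜 := ℂ) X v)).re

/-- Born's rule: the distribution `d ⟨v|ρ|v⟩ dv` of the outcome when the uniform POVM is measured
on the state `ρ`. -/
def bornLaw {d : ℕ} (ρ : Matrix (Fin d) (Fin d) ℂ) : Measure (ComplexSphere d) :=
  (uniformSphere d).withDensity fun v => ENNReal.ofReal (uniformPOVM ρ v)

/-- `V 0, …, V (n - 1)` are the outcomes of `n` independent uniform POVM measurements on `ρ`. -/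
structure IsUniformPOVMSample {d n : ℕ} {Ω : Type*} [MeasurableSpace Ω]
    (ρ : Matrix (Fin d) (Fin d) ℂ) (P : Measure Ω) (V : Fin n → Ω → ComplexSphere d) : Prop where
  measurable : ∀ i, Measurable (V i)
  indep : iIndepFun V P
  law : ∀ i, P.map (V i) = bornLaw ρ

/-- The least-squares objective of the uniform POVM for the observed outcomes `v 0, …, v (n - 1)`.

The frequencies form the empirical measure `f = (1/n) ∑ i, δ_{v i}` on the sphere. Expanding
`∫ (f(v) - d ⟨v|X|v⟩)² dv` and leaving out the term `∫ f(v)² dv`, which does not depend on `X` (and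
is not finite for a continuous POVM), gives
`∫ (d ⟨v|X|v⟩)² dv - 2 ∫ d ⟨v|X|v⟩ df(v)`. -/
def leastSquaresObjective {d n : ℕ} (v : Fin n → ComplexSphere d)
    (X : Matrix (Fin d) (Fin d) ℂ) : ℝ :=
  ∫ w, uniformPOVM X w ^ 2 ∂(uniformSphere d) - 2 * ((1 / (n : ℝ)) * ∑ i, uniformPOVM X (v i))

/-- `L` is a least-squares estimator for the outcomes `v`: a minimizer of the least-squares
objective over all Hermitian matrices. -/
def IsLeastSquaresEstimator {d n : ℕ} (v : Fin n → ComplexSphere d)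
    (L : Matrix (Fin d) (Fin d) ℂ) : Prop :=
  L.IsHermitian ∧
    ∀ X : Matrix (Fin d) (Fin d) ℂ, X.IsHermitian →
      leastSquaresObjective v L ≤ leastSquaresObjective v X

end

/-! The uniform POVM has explicit second moments, `∫ ⟨v|A|v⟩⟨v|B|v⟩ dv = (tr A tr B + tr AB) /
(d(d+1))` for Hermitian `A`, `B` (`integral_expVal_mul_expVal`). They turn the least-squares
objective into a strictly convex quadratic form whose unique minimizer is `L = ((d+1)/n) ∑
|v_i⟩⟨v_i| - 1`.

For a fixed unit vector `z`, `n⟨z|L-ρ|z⟩` is therefore a sum of independent centred variables `Y_i`.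
Comparing the volumes of an ellipsoid and a ball bounds the exponential moments of the overlap
`d|⟨z|v⟩|²` under `dv` (`integral_exp_overlap_le`). Since the Born density is bounded in `L²`
independently of `d`, this gives `E exp(tY) ≤ exp(30t²)` for `|t| ≤ 1/120`
(`integral_born_exp_deviation_le`).

To pass from fixed `z` to the operator norm, an average over uniform `z` replaces a net and a union
bound. If `‖L-ρ‖ ≥ τ`, then for one of the two signs `±⟨z|L-ρ|z⟩ ≥ τ/2` on a cap of measure at least
`9^(-d)` around an extremal eigenvector. The average over `z` of `exp(±tn⟨z|L-ρ|z⟩)` is then at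
least `9^(-d) exp(tnτ/2)`, while Fubini bounds its expectation by `exp(30t²n)`. Markov's inequality
with `t = τ/120` gives the tail; the two signs give the factor 2, and `9^d` gives `c₁ = 2 log 3`. -/

/-! ### Invariance of the uniform measure on the sphere -/

open scoped Pointwise in
/-- A linear isometry preserves the open cone over a subset of the sphere. -/
lemma Ioo_smul_image_preimage_sphere {d : ℕ}
    (U : EuclideanSpace ℂ (Fin d) ≃ₗᵢ[ℝ] EuclideanSpace ℂ (Fin d))
    (φ : ComplexSphere d → ComplexSphere d) (hφ : ∀ v, (φ v : EuclideanSpace ℂ (Fin d)) = U v)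
    (s : Set (ComplexSphere d)) :
    Ioo (0 : ℝ) 1 • ((↑) '' (φ ⁻¹' s) : Set (EuclideanSpace ℂ (Fin d))) =
      U ⁻¹' (Ioo (0 : ℝ) 1 • ((↑) '' s)) := by
  ext w
  constructor
  · rintro ⟨r, hr, _, ⟨v, hv, rfl⟩, rfl⟩
    exact ⟨r, hr, φ v, ⟨φ v, hv, rfl⟩, by simp [hφ]⟩
  · rintro ⟨r, hr, _, ⟨v, hv, rfl⟩, h⟩
    have hmem : U.symm v ∈ Metric.sphere (0 : EuclideanSpace ℂ (Fin d)) 1 := by simp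
    refine ⟨r, hr, U.symm v, ⟨⟨U.symm v, hmem⟩, ?_, rfl⟩, ?_⟩
    · have : φ ⟨U.symm v, hmem⟩ = v := Subtype.ext (by simp [hφ])
      rwa [mem_preimage, this]
    · simpa using congrArg U.symm h

lemma toSphere_univ_ne_zero {d : ℕ} [NeZero d] :
    (volume : Measure (EuclideanSpace ℂ (Fin d))).toSphere univ ≠ 0 := by
  rw [Ne, Measure.measure_univ_eq_zero]
  exact Measure.toSphere_ne_zero _

instance isProbabilityMeasure_uniformSphere {d : ℕ} [NeZero d] :
    IsProbabilityMeasure (uniformSphere d) :=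
  ⟨by
    rw [uniformSphere, Measure.smul_apply, smul_eq_mul,
      ENNReal.inv_mul_cancel toSphere_univ_ne_zero (measure_ne_top _ _)]⟩

/-- The uniform measure on the sphere is invariant under linear isometries. -/
lemma measurePreserving_uniformSphere {d : ℕ}
    (U : EuclideanSpace ℂ (Fin d) ≃ₗᵢ[ℝ] EuclideanSpace ℂ (Fin d))
    (φ : ComplexSphere d → ComplexSphere d) (hφ : ∀ v, (φ v : EuclideanSpace ℂ (Fin d)) = U v) :
    MeasurePreserving φ (uniformSphere d) (uniformSphere d) := by
  have hmeas : Measurable φ :=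
    (continuous_induced_rng.2 (by
      have : (Subtype.val ∘ φ) = fun v : ComplexSphere d => U v := funext hφ
      rw [this]; fun_prop)).measurable
  refine ⟨hmeas, ?_⟩
  rw [uniformSphere, Measure.map_smul]
  congr 1
  ext s hs
  rw [Measure.map_apply hmeas hs, Measure.toSphere_apply' _ (hmeas hs),
    Measure.toSphere_apply' _ hs, Ioo_smul_image_preimage_sphere U φ hφ]
  congr 1
  exact U.measurePreserving.measure_preimage_equiv (f := U.toMeasurableEquiv) _

lemma integral_comp_isometry_uniformSphere {d : ℕ}
    (U : EuclideanSpace ℂ (Fin d) ≃ₗᵢ[ℂ] EuclideanSpace ℂ (Fin d))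
    {f : EuclideanSpace ℂ (Fin d) → ℝ} (hf : Continuous f) :
    ∫ v, f (U v) ∂(uniformSphere d) = ∫ v, f v ∂(uniformSphere d) := by
  let W : EuclideanSpace ℂ (Fin d) ≃ₗᵢ[ℝ] EuclideanSpace ℂ (Fin d) :=
    { U.toLinearEquiv.restrictScalars ℝ with norm_map' := U.norm_map }
  let φ : ComplexSphere d → ComplexSphere d := fun v => ⟨U v, by simp⟩
  have h := measurePreserving_uniformSphere W φ (fun _ => rfl)
  have hmap := integral_map (μ := uniformSphere d) (f := fun v : ComplexSphere d => f v)
    h.measurable.aemeasurable (by fun_prop)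
  rw [h.map_eq] at hmap
  exact hmap.symm

/-! ### Volume comparison: caps and exponential moments of overlaps -/

lemma finrank_real_complexSpace (d : ℕ) :
    Module.finrank ℝ (EuclideanSpace ℂ (Fin d)) = 2 * d := by
  rw [← Module.finrank_mul_finrank ℝ ℂ, Complex.finrank_real_complex, finrank_euclideanSpace_fin]

/-- The ball of radius `1/3` around `2x/3` lies in the cone of vectors with squared overlap at least
`3/4` with `x`. -/
lemma overlap_of_mem_ball {E : Type*} [NormedAddCommGroup E] [InnerProductSpace ℂ E] {x w : E}
    (hx : ‖x‖ = 1) (hw : ‖w - ((2 / 3 : ℝ) : ℂ) • x‖ < 1 / 3) :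
    3 / 4 * ‖w‖ ^ 2 ≤ ‖inner ℂ x w‖ ^ 2 := by
  have h1 : ‖w - ((2 / 3 : ℝ) : ℂ) • x‖ ^ 2 = ‖w‖ ^ 2 - 4 / 3 * (inner ℂ x w).re + 4 / 9 := by
    have h0 : (inner ℂ w x).re = (inner ℂ x w).re := inner_re_symm (𝕜 := ℂ) w x
    rw [@norm_sub_sq ℂ, norm_smul, hx, inner_smul_right]
    simp only [RCLike.re_to_complex, Complex.re_ofReal_mul, Complex.norm_real, h0]
    norm_num
    ring
  have h2 : ‖w - ((2 / 3 : ℝ) : ℂ) • x‖ ^ 2 < 1 / 9 := by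
    nlinarith [norm_nonneg (w - ((2 / 3 : ℝ) : ℂ) • x)]
  have h3 : ‖w‖ ^ 2 + 1 / 3 < 4 / 3 * (inner ℂ x w).re := by linarith
  have h4 : (inner ℂ x w).re ≤ ‖inner ℂ x w‖ := Complex.re_le_norm _
  have h5 : (‖w‖ ^ 2 + 1 / 3) ^ 2 ≤ (4 / 3 * ‖inner ℂ x w‖) ^ 2 := by
    apply pow_le_pow_left₀ (by positivity); linarith
  -- By AM-GM `(‖w‖² + 1/3)² ≥ (4/3)‖w‖²`. Geometrically, the ball is seen from the origin under a
  -- half-angle with sine `1/2`, so cosine squared `3/4`.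
  nlinarith [sq_nonneg (‖w‖ ^ 2 - 1 / 3)]

/-- The cap of states with squared overlap at least `3/4` with a given state is not too small. -/
lemma cap_measure_ge {d : ℕ} [NeZero d] {x : EuclideanSpace ℂ (Fin d)} (hx : ‖x‖ = 1) :
    (1 / 9 : ℝ) ^ d ≤
      (uniformSphere d).real
        {v : ComplexSphere d | 3 / 4 ≤ ‖inner ℂ x (v : EuclideanSpace ℂ (Fin d))‖ ^ 2} := by
  set cap := {v : ComplexSphere d | 3 / 4 ≤ ‖inner ℂ x (v : EuclideanSpace ℂ (Fin d))‖ ^ 2}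
  have hcap : MeasurableSet cap :=
    measurableSet_le measurable_const (by fun_prop)
  set y : EuclideanSpace ℂ (Fin d) := ((2 / 3 : ℝ) : ℂ) • x with hy
  have hyn : ‖y‖ = 2 / 3 := by rw [hy, norm_smul, hx]; norm_num
  -- Since `2/3 + 1/3 = 1`, this ball stays in the unit ball, hence in the cone over the cap. Real
  -- dimension `2d` makes its relative volume `(1/3)^(2d) = 9^(-d)`.
  have hsub : Metric.ball y (1 / 3) ⊆
      image2 (fun (r : ℝ) (v : EuclideanSpace ℂ (Fin d)) => r • v) (Ioo (0 : ℝ) 1)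
        ((↑) '' cap) := by
    intro w hw
    rw [Metric.mem_ball, dist_eq_norm] at hw
    have hwn : 0 < ‖w‖ := by
      have := norm_sub_norm_le y w
      rw [norm_sub_rev] at this
      linarith
    have hw1 : ‖w‖ < 1 := by
      have := norm_sub_norm_le w y
      linarith
    refine ⟨‖w‖, ⟨hwn, hw1⟩, (‖w‖⁻¹ : ℝ) • w, ⟨⟨(‖w‖⁻¹ : ℝ) • w, ?_⟩, ?_, rfl⟩, ?_⟩
    · simp [norm_smul, hwn.ne']
    · have := overlap_of_mem_ball hx hw
      change 3 / 4 ≤ ‖inner ℂ x ((‖w‖⁻¹ : ℝ) • w)‖ ^ 2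
      rw [inner_smul_right_eq_smul, norm_smul, mul_pow, norm_inv, norm_norm, inv_pow,
        ← div_eq_inv_mul, le_div_iff₀ (by positivity)]
      exact this
    · simp [smul_smul, hwn.ne']
  have hball : (volume (Metric.ball y (1 / 3))) =
      ENNReal.ofReal ((1 / 9 : ℝ) ^ d) *
        volume (Metric.ball (0 : EuclideanSpace ℂ (Fin d)) 1) := by
    rw [Measure.addHaar_ball _ _ (by norm_num), finrank_real_complexSpace, pow_mul]
    norm_num
  rw [measureReal_def, ← ENNReal.ofReal_le_iff_le_toReal (measure_ne_top _ _), uniformSphere,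
    Measure.smul_apply, smul_eq_mul, ← ENNReal.div_eq_inv_mul,
    ENNReal.le_div_iff_mul_le (.inl toSphere_univ_ne_zero) (.inl (measure_ne_top _ _)),
    Measure.toSphere_apply_univ, Measure.toSphere_apply' _ hcap, mul_left_comm, ← hball]
  gcongr
  exact hsub

/-- The map shrinking the direction of a unit vector `z` by the factor `t`. -/
lemma exists_shrink {d : ℕ} {z : EuclideanSpace ℂ (Fin d)} (hz : ‖z‖ = 1) {s : ℝ} (hs1 : s < 1) :
    ∃ T : EuclideanSpace ℂ (Fin d) →ₗ[ℝ] EuclideanSpace ℂ (Fin d),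
      LinearMap.det T = 1 - s ∧ ∀ w, ‖T w‖ ^ 2 = ‖w‖ ^ 2 - s * ‖inner ℂ z w‖ ^ 2 := by
  -- The real determinant is the squared modulus of the complex one, so shrinking by `√(1 - s)`
  -- gives `1 - s`.
  set t : ℝ := √(1 - s)
  have ht : t ^ 2 = 1 - s := Real.sq_sqrt (by linarith)
  refine ⟨(LinearMap.transvection (innerSL ℂ z).toLinearMap
    (((t - 1 : ℝ) : ℂ) • z)).restrictScalars ℝ, ?_, ?_⟩
  · rw [LinearMap.det_restrictScalars, LinearMap.transvection.det, Algebra.norm_complex_apply]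
    have : (1 : ℂ) + (innerSL ℂ z).toLinearMap (((t - 1 : ℝ) : ℂ) • z) = (t : ℂ) := by
      simp [hz]
    rw [this, Complex.normSq_ofReal, ← sq, ht]
  · intro w
    have : ((LinearMap.transvection (innerSL ℂ z).toLinearMap
        (((t - 1 : ℝ) : ℂ) • z)).restrictScalars ℝ) w
        = w + (inner ℂ z w * ((t - 1 : ℝ) : ℂ)) • z := by
      simp [LinearMap.transvection.apply, smul_smul]
    rw [this, @norm_add_sq ℂ, norm_smul, hz, inner_smul_right, ← inner_conj_symm w z]
    have h2 : RCLike.re (inner ℂ z w * ((t - 1 : ℝ) : ℂ) * (starRingEnd ℂ) (inner ℂ z w))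
        = (t - 1) * ‖inner ℂ z w‖ ^ 2 := by
      rw [mul_right_comm, Complex.mul_conj, Complex.normSq_eq_norm_sq, ← Complex.ofReal_mul]
      exact (Complex.ofReal_re _).trans (mul_comm _ _)
    have h3 : ‖inner ℂ z w * ((t - 1 : ℝ) : ℂ)‖ ^ 2 = ‖inner ℂ z w‖ ^ 2 * (t - 1) ^ 2 := by
      rw [norm_mul, mul_pow, Complex.norm_real, Real.norm_eq_abs, sq_abs]
    rw [h2, mul_one, h3]
    linear_combination ‖inner ℂ z w‖ ^ 2 * ht

/-- Exponential moments of the overlap with a fixed state, by comparing the volume of an ellipsoid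
with its expression in polar coordinates. -/
lemma integral_exp_overlap_le {d : ℕ} [NeZero d] {z : EuclideanSpace ℂ (Fin d)} (hz : ‖z‖ = 1)
    {s : ℝ} (hs1 : s < 1) :
    ∫ v : ComplexSphere d, Real.exp (s * (d * ‖inner ℂ z (v : EuclideanSpace ℂ (Fin d))‖ ^ 2))
      ∂(uniformSphere d) ≤ (1 - s)⁻¹ := by
  obtain ⟨T, hdet, hT⟩ := exists_shrink hz hs1
  have hpos : 0 < 1 - s := by linarith
  have hd : (0 : ℝ) < d := Nat.cast_pos.2 (Nat.pos_of_ne_zero (NeZero.ne d))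
  set μ : Measure (EuclideanSpace ℂ (Fin d)) := volume with hμ
  set S : Set (EuclideanSpace ℂ (Fin d)) := T ⁻¹' Metric.ball 0 1
  have hS : μ S = ENNReal.ofReal (1 - s)⁻¹ * μ (Metric.ball 0 1) := by
    rw [Measure.addHaar_preimage_linearMap _ (by rw [hdet]; exact hpos.ne'), hdet,
      abs_of_pos (inv_pos.2 hpos)]
  -- The ellipsoid `S` reaches out to `(1 - s|⟨z,v⟩|²)^(-1/2)` in direction `v`, which is at least
  -- `R v` because `1 - x ≤ exp(-x)`. The `2d`-th power of `R v` is the integrand of the statement.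
  set R : ComplexSphere d → ℝ := fun v =>
    Real.exp (s * ‖inner ℂ z (v : EuclideanSpace ℂ (Fin d))‖ ^ 2 / 2) with hR
  set K : Set (ComplexSphere d × Ioi (0 : ℝ)) := {p | (p.2 : ℝ) < R p.1}
  have hK : MeasurableSet K := measurableSet_lt (by fun_prop) (by fun_prop)
  have hmp := Measure.measurePreserving_homeomorphUnitSphereProd μ
  have hle : (μ.toSphere.prod (Measure.volumeIoiPow
      (Module.finrank ℝ (EuclideanSpace ℂ (Fin d)) - 1))) K ≤ μ S := by
    rw [← hmp.measure_preimage hK.nullMeasurableSet,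
      comap_subtype_coe_apply (measurableSet_singleton _).compl]
    apply measure_mono
    rintro _ ⟨w, hw, rfl⟩
    have hwn : 0 < ‖(w : EuclideanSpace ℂ (Fin d))‖ := norm_pos_iff.2 w.2
    have hw' : ‖(w : EuclideanSpace ℂ (Fin d))‖ <
        Real.exp (s * ‖inner ℂ z ((‖(w : EuclideanSpace ℂ (Fin d))‖⁻¹ : ℝ) •
          (w : EuclideanSpace ℂ (Fin d)))‖ ^ 2 / 2) := by
      simpa [K, hR] using hw
    rw [mem_preimage, Metric.mem_ball, dist_zero_right, ← sq_lt_one_iff₀ (norm_nonneg _), hT]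
    rw [inner_smul_right_eq_smul, norm_smul, mul_pow, norm_inv, norm_norm, inv_pow] at hw'
    set r := ‖(w : EuclideanSpace ℂ (Fin d))‖
    set u := ‖inner ℂ z (w : EuclideanSpace ℂ (Fin d))‖ ^ 2
    have h1 : r ^ 2 < Real.exp (s * ((r ^ 2)⁻¹ * u)) := by
      calc r ^ 2 < Real.exp (s * ((r ^ 2)⁻¹ * u) / 2) ^ 2 :=
            pow_lt_pow_left₀ hw' hwn.le (by norm_num)
        _ = _ := by rw [← Real.exp_nat_mul]; congr 1; push_cast; ring
    have h2 : 1 - s * ((r ^ 2)⁻¹ * u) ≤ Real.exp (-(s * ((r ^ 2)⁻¹ * u))) := by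
      have := Real.add_one_le_exp (-(s * ((r ^ 2)⁻¹ * u))); linarith
    calc r ^ 2 - s * u = r ^ 2 * (1 - s * ((r ^ 2)⁻¹ * u)) := by field_simp
      _ ≤ r ^ 2 * Real.exp (-(s * ((r ^ 2)⁻¹ * u))) := by gcongr
      _ < Real.exp (s * ((r ^ 2)⁻¹ * u)) * Real.exp (-(s * ((r ^ 2)⁻¹ * u))) := by gcongr
      _ = 1 := by rw [← Real.exp_add]; simp
  have hprod : (μ.toSphere.prod (Measure.volumeIoiPow
      (Module.finrank ℝ (EuclideanSpace ℂ (Fin d)) - 1))) K =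
      ENNReal.ofReal (1 / (2 * d)) * ∫⁻ v : ComplexSphere d, ENNReal.ofReal
        (Real.exp (s * (d * ‖inner ℂ z (v : EuclideanSpace ℂ (Fin d))‖ ^ 2))) ∂μ.toSphere := by
    rw [Measure.prod_apply hK, ← lintegral_const_mul _ (by fun_prop)]
    refine lintegral_congr fun v => ?_
    have : Prod.mk v ⁻¹' K = Iio (⟨R v, Real.exp_pos _⟩ : Ioi (0 : ℝ)) := by
      ext r; simp [K, ← Subtype.coe_lt_coe]
    -- The radial density is `r^(2d-1)`, with truncated subtraction; integrating it up to `R v`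
    -- gives `(R v)^(2d) / (2d)`.
    have h2d : 1 ≤ 2 * d := by have := NeZero.ne d; omega
    rw [this, Measure.volumeIoiPow_apply_Iio, finrank_real_complexSpace,
      ← ENNReal.ofReal_mul (by positivity), Nat.sub_add_cancel h2d, Nat.cast_sub h2d]
    congr 1
    change Real.exp _ ^ (2 * d) / _ = _
    rw [← Real.exp_nat_mul]
    push_cast
    rw [sub_add_cancel, div_eq_inv_mul, one_div]
    congr 2
    ring
  rw [hprod, hS] at hle
  have huniv := Measure.toSphere_apply_univ μ
  rw [finrank_real_complexSpace] at huniv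
  rw [integral_eq_lintegral_of_nonneg_ae (ae_of_all _ fun _ => (Real.exp_pos _).le)
    (by fun_prop)]
  apply ENNReal.toReal_le_of_le_ofReal (inv_pos.2 hpos).le
  rw [uniformSphere, lintegral_smul_measure, smul_eq_mul, ← ENNReal.div_eq_inv_mul]
  apply ENNReal.div_le_of_le_mul
  rw [← hμ, huniv]
  have hc : ENNReal.ofReal (1 / (2 * d)) = ((2 * d : ℕ) : ENNReal)⁻¹ := by
    rw [one_div, ENNReal.ofReal_inv_of_pos (by positivity)]
    congr 1
    rw [← ENNReal.ofReal_natCast]; push_cast; rfl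
  rw [hc, ← ENNReal.div_eq_inv_mul, ENNReal.div_le_iff
    (by simp [NeZero.ne d]) (ENNReal.natCast_ne_top _)] at hle
  rw [mul_comm ((2 * d : ℕ) : ENNReal), ← mul_assoc]
  exact hle

/-! ### Expectation values and rank-one matrices -/

noncomputable section

/-- The expectation value `⟨v|A|v⟩`. -/
def expVal {d : ℕ} (A : Matrix (Fin d) (Fin d) ℂ) (v : EuclideanSpace ℂ (Fin d)) : ℝ :=
  (inner ℂ v (Matrix.toEuclideanCLM (n := Fin d) (𝕜 := ℂ) A v)).re

/-- The matrix `|z⟩⟨z|`. -/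
def outer {d : ℕ} (z : EuclideanSpace ℂ (Fin d)) : Matrix (Fin d) (Fin d) ℂ :=
  Matrix.vecMulVec z.ofLp (star z.ofLp)

lemma uniformPOVM_eq {d : ℕ} (X : Matrix (Fin d) (Fin d) ℂ) (v : ComplexSphere d) :
    uniformPOVM X v = d * expVal X v := rfl

@[fun_prop]
lemma continuous_expVal {d : ℕ} (A : Matrix (Fin d) (Fin d) ℂ) : Continuous (expVal A) := by
  unfold expVal; fun_prop

lemma expVal_add {d : ℕ} (A B : Matrix (Fin d) (Fin d) ℂ) (v : EuclideanSpace ℂ (Fin d)) :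
    expVal (A + B) v = expVal A v + expVal B v := by
  simp [expVal]

lemma expVal_sub {d : ℕ} (A B : Matrix (Fin d) (Fin d) ℂ) (v : EuclideanSpace ℂ (Fin d)) :
    expVal (A - B) v = expVal A v - expVal B v := by
  simp [expVal]

lemma expVal_smul {d : ℕ} (c : ℝ) (A : Matrix (Fin d) (Fin d) ℂ) (v : EuclideanSpace ℂ (Fin d)) :
    expVal ((c : ℂ) • A) v = c * expVal A v := by
  rw [expVal, map_smul, smul_apply, inner_smul_right, Complex.re_ofReal_mul, expVal]

lemma expVal_sum {d : ℕ} {ι : Type*} (s : Finset ι) (A : ι → Matrix (Fin d) (Fin d) ℂ)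
    (v : EuclideanSpace ℂ (Fin d)) : expVal (∑ i ∈ s, A i) v = ∑ i ∈ s, expVal (A i) v := by
  simp [expVal]

lemma expVal_one {d : ℕ} (v : EuclideanSpace ℂ (Fin d)) : expVal 1 v = ‖v‖ ^ 2 := by
  simp only [expVal, map_one, one_apply_eq_self]
  exact (norm_sq_eq_re_inner (𝕜 := ℂ) v).symm

lemma toEuclideanCLM_outer {d : ℕ} (z v : EuclideanSpace ℂ (Fin d)) :
    Matrix.toEuclideanCLM (n := Fin d) (𝕜 := ℂ) (outer z) v = inner ℂ z v • z := by
  ext i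
  rw [Matrix.ofLp_toEuclideanCLM, outer, Matrix.vecMulVec_mulVec]
  simp [EuclideanSpace.inner_eq_star_dotProduct, dotProduct_comm, mul_comm]

lemma expVal_outer {d : ℕ} (z v : EuclideanSpace ℂ (Fin d)) :
    expVal (outer z) v = ‖inner ℂ z v‖ ^ 2 := by
  rw [expVal, toEuclideanCLM_outer, inner_smul_right, ← inner_conj_symm v z, Complex.mul_conj,
    Complex.normSq_eq_norm_sq]
  exact Complex.ofReal_re _

lemma isHermitian_outer {d : ℕ} (z : EuclideanSpace ℂ (Fin d)) : (outer z).IsHermitian := by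
  rw [Matrix.IsHermitian, outer, Matrix.conjTranspose_vecMulVec, star_star]

lemma trace_mul_outer {d : ℕ} (A : Matrix (Fin d) (Fin d) ℂ) (z : EuclideanSpace ℂ (Fin d)) :
    (A * outer z).trace.re = expVal A z := by
  rw [outer, Matrix.mul_vecMulVec, Matrix.trace_vecMulVec, expVal,
    EuclideanSpace.inner_eq_star_dotProduct, Matrix.ofLp_toEuclideanCLM]

lemma trace_outer {d : ℕ} (z : EuclideanSpace ℂ (Fin d)) : (outer z).trace.re = ‖z‖ ^ 2 := by
  rw [← one_mul (outer z), trace_mul_outer, expVal_one]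

/-! ### Second moments of the uniform POVM -/

lemma integrable_uniformSphere {d : ℕ} [NeZero d] {f : ComplexSphere d → ℝ} (hf : Continuous f) :
    Integrable f (uniformSphere d) :=
  hf.integrable_of_hasCompactSupport (HasCompactSupport.of_compactSpace f)

/-- The fourth moment of the overlap with a unit vector does not depend on the vector. -/
lemma integral_overlap_sq_eq_coord {d : ℕ} (i : Fin d) {z : EuclideanSpace ℂ (Fin d)}
    (hz : ‖z‖ = 1) :
    ∫ v : ComplexSphere d, (‖inner ℂ z (v : EuclideanSpace ℂ (Fin d))‖ ^ 2) ^ 2 ∂(uniformSphere d) =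
      ∫ v : ComplexSphere d, (‖(v : EuclideanSpace ℂ (Fin d)) i‖ ^ 2) ^ 2 ∂(uniformSphere d) := by
  -- The coordinate isometry of an orthonormal basis containing `z` carries the overlap with `z` to
  -- the `i`-th coordinate.
  obtain ⟨b, hb⟩ := Orthonormal.exists_orthonormalBasis_extension_of_card_eq (𝕜 := ℂ)
    (E := EuclideanSpace ℂ (Fin d)) (ι := Fin d) (by simp) (v := fun _ => z) (s := {i})
    ⟨fun _ => hz, fun j k hjk => (hjk (Subsingleton.elim _ _)).elim⟩
  have hb' : b i = z := hb i rfl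
  have := integral_comp_isometry_uniformSphere b.repr
    (f := fun w => (‖w i‖ ^ 2) ^ 2) (by fun_prop)
  simpa [OrthonormalBasis.repr_apply_apply, hb'] using this

/-- Summing over the four phases `±1, ±i` cancels every term that depends on the relative phase of
`c` and `e`. This isolates the mixed moment. -/
lemma sum_phases_norm_pow_four (c e : ℂ) :
    (‖c + e‖ ^ 2) ^ 2 + (‖c - e‖ ^ 2) ^ 2 + (‖c + Complex.I * e‖ ^ 2) ^ 2 +
      (‖c - Complex.I * e‖ ^ 2) ^ 2 =
      4 * (‖c‖ ^ 2) ^ 2 + 4 * (‖e‖ ^ 2) ^ 2 + 16 * (‖c‖ ^ 2 * ‖e‖ ^ 2) := by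
  simp only [← Complex.normSq_eq_norm_sq, Complex.normSq_apply, Complex.add_re, Complex.add_im,
    Complex.sub_re, Complex.sub_im, Complex.mul_re, Complex.mul_im, Complex.I_re, Complex.I_im]
  ring

/-- The mixed fourth moment of the overlaps with two orthogonal unit vectors. -/
lemma integral_overlap_mul_overlap {d : ℕ} [NeZero d] {a : ℝ}
    (ha : ∀ z : EuclideanSpace ℂ (Fin d), ‖z‖ = 1 →
      ∫ v : ComplexSphere d, (‖inner ℂ z (v : EuclideanSpace ℂ (Fin d))‖ ^ 2) ^ 2
        ∂(uniformSphere d) = a)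
    {y z : EuclideanSpace ℂ (Fin d)} (hy : ‖y‖ = 1) (hz : ‖z‖ = 1) (hyz : inner ℂ y z = 0) :
    ∫ v : ComplexSphere d, ‖inner ℂ y (v : EuclideanSpace ℂ (Fin d))‖ ^ 2 *
      ‖inner ℂ z (v : EuclideanSpace ℂ (Fin d))‖ ^ 2 ∂(uniformSphere d) = a / 2 := by
  -- The integrand is the overlap with a vector of norm `√2`, conjugated in `ω` because the inner
  -- product is antilinear on the left; normalizing it gives `(√2)^4 a = 4a`.
  have key : ∀ ω : ℂ, ‖ω‖ = 1 → ∫ v : ComplexSphere d,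
      (‖inner ℂ y (v : EuclideanSpace ℂ (Fin d)) +
        ω * inner ℂ z (v : EuclideanSpace ℂ (Fin d))‖ ^ 2) ^ 2 ∂(uniformSphere d) = 4 * a := by
    intro ω hω
    have hn : ‖y + (starRingEnd ℂ ω) • z‖ ^ 2 = 2 := by
      rw [@norm_add_sq ℂ, inner_smul_right, hyz, norm_smul, hy, hz, RCLike.norm_conj, hω]
      norm_num
    have hn' : ‖y + (starRingEnd ℂ ω) • z‖ = √2 := by
      rw [← hn, Real.sqrt_sq (norm_nonneg _)]
    have h := ha (((√2)⁻¹ : ℂ) • (y + (starRingEnd ℂ ω) • z)) (by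
      rw [norm_smul, hn']; simp [abs_of_nonneg])
    rw [← h, ← integral_const_mul]
    refine integral_congr_ae (ae_of_all _ fun v => ?_)
    simp only [inner_smul_left, inner_add_left, norm_mul, mul_pow, Complex.conj_conj]
    simp only [map_inv₀, Complex.conj_ofReal, norm_inv, Complex.norm_real, Real.norm_eq_abs,
      inv_pow, sq_abs, Real.sq_sqrt (zero_le_two (α := ℝ))]
    ring
  have hsum : ∫ v : ComplexSphere d, (4 * (‖inner ℂ y (v : EuclideanSpace ℂ (Fin d))‖ ^ 2) ^ 2 +
      4 * (‖inner ℂ z (v : EuclideanSpace ℂ (Fin d))‖ ^ 2) ^ 2 +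
      16 * (‖inner ℂ y (v : EuclideanSpace ℂ (Fin d))‖ ^ 2 *
        ‖inner ℂ z (v : EuclideanSpace ℂ (Fin d))‖ ^ 2)) ∂(uniformSphere d) = 16 * a := by
    have k1 := key 1 (by simp)
    have k2 := key (-1) (by simp)
    have k3 := key Complex.I (by simp)
    have k4 := key (-Complex.I) (by simp)
    simp only [one_mul, neg_mul, ← sub_eq_add_neg] at k1 k2 k3 k4
    simp only [← sum_phases_norm_pow_four]
    rw [integral_add (integrable_uniformSphere (by fun_prop)) (integrable_uniformSphere (by fun_prop)),
      integral_add (integrable_uniformSphere (by fun_prop)) (integrable_uniformSphere (by fun_prop)),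
      integral_add (integrable_uniformSphere (by fun_prop)) (integrable_uniformSphere (by fun_prop)),
      k1, k2, k3, k4]
    ring
  rw [integral_add (integrable_uniformSphere (by fun_prop)) (integrable_uniformSphere (by fun_prop)),
    integral_add (integrable_uniformSphere (by fun_prop)) (integrable_uniformSphere (by fun_prop)),
    integral_const_mul, integral_const_mul, integral_const_mul, ha y hy, ha z hz] at hsum
  linarith

/-- The moment matrix of the overlaps with an orthonormal basis is `(a/2)(1 + δ_ij)`. The constant
`a` stays free here because its value is deduced from this identity. -/
lemma integral_sq_sum_overlap {d : ℕ} [NeZero d] {a : ℝ}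
    (ha : ∀ z : EuclideanSpace ℂ (Fin d), ‖z‖ = 1 →
      ∫ v : ComplexSphere d, (‖inner ℂ z (v : EuclideanSpace ℂ (Fin d))‖ ^ 2) ^ 2
        ∂(uniformSphere d) = a)
    (b : OrthonormalBasis (Fin d) ℂ (EuclideanSpace ℂ (Fin d))) (l : Fin d → ℝ) :
    ∫ v : ComplexSphere d, (∑ i, l i * ‖inner ℂ (b i) (v : EuclideanSpace ℂ (Fin d))‖ ^ 2) ^ 2
      ∂(uniformSphere d) = a / 2 * ((∑ i, l i) ^ 2 + ∑ i, l i ^ 2) := by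
  have hij : ∀ i j, ∫ v : ComplexSphere d, ‖inner ℂ (b i) (v : EuclideanSpace ℂ (Fin d))‖ ^ 2 *
      ‖inner ℂ (b j) (v : EuclideanSpace ℂ (Fin d))‖ ^ 2 ∂(uniformSphere d) =
      a / 2 * (1 + if i = j then 1 else 0) := by
    intro i j
    by_cases h : i = j
    · subst h
      rw [if_pos rfl, ← ha (b i) (b.norm_eq_one i)]
      simp only [← sq]
      ring
    · rw [if_neg h, integral_overlap_mul_overlap ha (b.norm_eq_one i) (b.norm_eq_one j)
        (b.inner_eq_zero h)]
      ring
  simp only [sq (∑ i, l i * _), Finset.sum_mul_sum]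
  rw [integral_finsetSum _ fun i _ => integrable_uniformSphere (by fun_prop)]
  rw [sq (∑ i, l i), Finset.sum_mul_sum, ← Finset.sum_add_distrib, Finset.mul_sum]
  refine Finset.sum_congr rfl fun i _ => ?_
  rw [integral_finsetSum _ fun i _ => integrable_uniformSphere (by fun_prop)]
  simp only [mul_mul_mul_comm (l _), integral_const_mul, hij]
  simp only [mul_add, mul_one, mul_ite, mul_zero, Finset.sum_add_distrib, Finset.sum_ite_eq,
    Finset.mem_univ, if_true, ← Finset.mul_sum, ← Finset.sum_mul, sq]
  ring

/-- The fourth moment of the overlap with a unit vector. -/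
lemma integral_overlap_sq {d : ℕ} [NeZero d] {z : EuclideanSpace ℂ (Fin d)} (hz : ‖z‖ = 1) :
    ∫ v : ComplexSphere d, (‖inner ℂ z (v : EuclideanSpace ℂ (Fin d))‖ ^ 2) ^ 2
      ∂(uniformSphere d) = 2 / (d * (d + 1)) := by
  have ha : ∀ z : EuclideanSpace ℂ (Fin d), ‖z‖ = 1 → _ :=
    fun z hz => integral_overlap_sq_eq_coord (0 : Fin d) hz
  -- With unit weights the overlaps sum to 1, so `1 = (a/2)(d² + d)` determines `a`.
  have h := integral_sq_sum_overlap ha (EuclideanSpace.basisFun (Fin d) ℂ) (fun _ => 1)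
  simp only [one_mul, OrthonormalBasis.sum_sq_norm_inner_right, norm_eq_of_mem_sphere, one_pow,
    integral_const, probReal_univ, smul_eq_mul, Finset.sum_const, Finset.card_univ, nsmul_eq_mul,
    Fintype.card_fin, mul_one] at h
  rw [ha z hz]
  have hd : (d : ℝ) ≠ 0 := Nat.cast_ne_zero.2 (NeZero.ne d)
  rw [eq_div_iff (by positivity)]
  linarith

lemma toEuclideanCLM_eq_sum_eigenvalues {d : ℕ} {A : Matrix (Fin d) (Fin d) ℂ}
    (hA : A.IsHermitian) (v : EuclideanSpace ℂ (Fin d)) :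
    Matrix.toEuclideanCLM (n := Fin d) (𝕜 := ℂ) A v =
      ∑ i, (inner ℂ (hA.eigenvectorBasis i) v * (hA.eigenvalues i : ℂ)) •
        hA.eigenvectorBasis i := by
  have hAe : ∀ i, Matrix.toEuclideanCLM (n := Fin d) (𝕜 := ℂ) A (hA.eigenvectorBasis i) =
      (hA.eigenvalues i : ℂ) • hA.eigenvectorBasis i := by
    intro i
    apply WithLp.ofLp_injective
    rw [Matrix.ofLp_toEuclideanCLM, hA.mulVec_eigenvectorBasis]
    ext j; simp
  conv_lhs => rw [← hA.eigenvectorBasis.sum_repr' v]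
  simp only [map_sum, map_smul, hAe, smul_smul]

lemma expVal_eq_sum_eigenvalues {d : ℕ} {A : Matrix (Fin d) (Fin d) ℂ} (hA : A.IsHermitian)
    (v : EuclideanSpace ℂ (Fin d)) :
    expVal A v = ∑ i, hA.eigenvalues i * ‖inner ℂ (hA.eigenvectorBasis i) v‖ ^ 2 := by
  rw [expVal, toEuclideanCLM_eq_sum_eigenvalues hA, inner_sum, Complex.re_sum]
  refine Finset.sum_congr rfl fun i _ => ?_
  rw [inner_smul_right, ← inner_conj_symm v, mul_right_comm, Complex.mul_conj,
    Complex.normSq_eq_norm_sq, ← Complex.ofReal_mul, mul_comm]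
  exact Complex.ofReal_re _

lemma trace_sq_eq_sum_eigenvalues {d : ℕ} {A : Matrix (Fin d) (Fin d) ℂ} (hA : A.IsHermitian) :
    (A * A).trace.re = ∑ i, hA.eigenvalues i ^ 2 := by
  have h : A * A = hA.eigenvectorUnitary.1 * (Matrix.diagonal fun i => (hA.eigenvalues i ^ 2 : ℂ)) *
      star hA.eigenvectorUnitary.1 := by
    conv_lhs => rw [hA.spectral_theorem]
    rw [← map_mul, Matrix.diagonal_mul_diagonal, Unitary.conjStarAlgAut_apply]
    simp [sq]
  rw [h, Matrix.trace_mul_cycle, Unitary.coe_star_mul_self, one_mul, Matrix.trace_diagonal,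
    Complex.re_sum]
  simp [← Complex.ofReal_pow]

lemma integral_expVal_sq {d : ℕ} [NeZero d] {A : Matrix (Fin d) (Fin d) ℂ} (hA : A.IsHermitian) :
    ∫ v : ComplexSphere d, expVal A v ^ 2 ∂(uniformSphere d) =
      (A.trace.re ^ 2 + (A * A).trace.re) / (d * (d + 1)) := by
  simp only [expVal_eq_sum_eigenvalues hA]
  rw [integral_sq_sum_overlap fun z hz => integral_overlap_sq hz, trace_sq_eq_sum_eigenvalues hA,
    hA.trace_eq_sum_eigenvalues, Complex.re_sum]
  simp only [Complex.coe_algebraMap, Complex.ofReal_re]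
  ring

/-- The second moments of the uniform POVM. -/
lemma integral_expVal_mul_expVal {d : ℕ} [NeZero d] {A B : Matrix (Fin d) (Fin d) ℂ}
    (hA : A.IsHermitian) (hB : B.IsHermitian) :
    ∫ v : ComplexSphere d, expVal A v * expVal B v ∂(uniformSphere d) =
      (A.trace.re * B.trace.re + (A * B).trace.re) / (d * (d + 1)) := by
  have h := integral_expVal_sq (hA.add hB)
  have e : ∀ v : ComplexSphere d, expVal (A + B) v ^ 2 =
      expVal A v ^ 2 + expVal B v ^ 2 + 2 * (expVal A v * expVal B v) := fun v => by
    rw [expVal_add]; ring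
  simp only [e] at h
  rw [integral_add (integrable_uniformSphere (by fun_prop)) (integrable_uniformSphere (by fun_prop)),
    integral_add (integrable_uniformSphere (by fun_prop)) (integrable_uniformSphere (by fun_prop)),
    integral_const_mul, integral_expVal_sq hA, integral_expVal_sq hB, Matrix.add_mul,
    Matrix.mul_add, Matrix.mul_add] at h
  simp only [Matrix.trace_add, Matrix.trace_mul_comm B A, Complex.add_re] at h
  linear_combination h / 2

/-! ### The least-squares estimator -/

/-- The closed form of the least-squares estimator. -/
def lsEstimate {d n : ℕ} (v : Fin n → ComplexSphere d) : Matrix (Fin d) (Fin d) ℂ :=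
  (((d + 1) / n : ℝ) : ℂ) • ∑ i, outer (v i : EuclideanSpace ℂ (Fin d)) - 1

lemma isHermitian_lsEstimate {d n : ℕ} (v : Fin n → ComplexSphere d) :
    (lsEstimate v).IsHermitian := by
  refine Matrix.IsHermitian.sub ?_ Matrix.isHermitian_one
  rw [Matrix.IsHermitian, Matrix.conjTranspose_smul, Matrix.conjTranspose_sum]
  simp [(isHermitian_outer _).eq]

lemma expVal_lsEstimate {d n : ℕ} (v : Fin n → ComplexSphere d) (z : ComplexSphere d) :
    expVal (lsEstimate v) z = (d + 1) / n *
      ∑ i, ‖inner ℂ (z : EuclideanSpace ℂ (Fin d)) (v i : EuclideanSpace ℂ (Fin d))‖ ^ 2 - 1 := by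
  rw [lsEstimate, expVal_sub, expVal_smul, expVal_sum, expVal_one, norm_eq_of_mem_sphere]
  simp [expVal_outer, norm_inner_symm (z : EuclideanSpace ℂ (Fin d))]

lemma trace_lsEstimate {d n : ℕ} (hn : 0 < n) (v : Fin n → ComplexSphere d) :
    (lsEstimate v).trace.re = 1 := by
  have hn' : (n : ℝ) ≠ 0 := by positivity
  rw [lsEstimate, Matrix.trace_sub, Matrix.trace_smul, Matrix.trace_sum, Complex.sub_re, smul_eq_mul,
    Complex.re_ofReal_mul, Complex.re_sum]
  simp [trace_outer]
  field_simp
  ring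

lemma trace_lsEstimate_mul {d n : ℕ} (v : Fin n → ComplexSphere d)
    (H : Matrix (Fin d) (Fin d) ℂ) :
    (lsEstimate v * H).trace.re = (d + 1) / n * ∑ i, expVal H (v i) - H.trace.re := by
  rw [Matrix.trace_mul_comm, lsEstimate, Matrix.mul_sub, Matrix.mul_smul, Matrix.mul_sum,
    Matrix.trace_sub, Matrix.trace_smul, Matrix.trace_sum, Complex.sub_re, smul_eq_mul,
    Complex.re_ofReal_mul, Complex.re_sum, mul_one]
  simp only [trace_mul_outer]

/-- The normal equation of the least-squares problem. -/
lemma integral_expVal_lsEstimate_mul {d n : ℕ} [NeZero d] (hn : 0 < n)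
    (v : Fin n → ComplexSphere d) {H : Matrix (Fin d) (Fin d) ℂ} (hH : H.IsHermitian) :
    ∫ w : ComplexSphere d, expVal (lsEstimate v) w * expVal H w ∂(uniformSphere d) =
      1 / (n * d) * ∑ i, expVal H (v i) := by
  have hd : (d : ℝ) ≠ 0 := Nat.cast_ne_zero.2 (NeZero.ne d)
  have hn' : (n : ℝ) ≠ 0 := by positivity
  rw [integral_expVal_mul_expVal (isHermitian_lsEstimate v) hH, trace_lsEstimate hn,
    trace_lsEstimate_mul]
  field_simp
  ring

/-- Completing the square: the normal equation cancels the terms linear in `X - lsEstimate v`. -/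
lemma leastSquaresObjective_eq {d n : ℕ} [NeZero d] (hn : 0 < n) (v : Fin n → ComplexSphere d)
    {X : Matrix (Fin d) (Fin d) ℂ} (hX : X.IsHermitian) :
    leastSquaresObjective v X = leastSquaresObjective v (lsEstimate v) +
      d ^ 2 * ∫ w : ComplexSphere d, expVal (X - lsEstimate v) w ^ 2 ∂(uniformSphere d) := by
  set L := lsEstimate v
  set H := X - L
  have hXH : X = L + H := by simp [H]
  have hd : (d : ℝ) ≠ 0 := Nat.cast_ne_zero.2 (NeZero.ne d)
  have hn' : (n : ℝ) ≠ 0 := by positivity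
  have hnorm := integral_expVal_lsEstimate_mul hn v (hX.sub (isHermitian_lsEstimate v))
  have e : ∀ w : ComplexSphere d, expVal (L + H) w ^ 2 =
      expVal L w ^ 2 + expVal H w ^ 2 + 2 * (expVal L w * expVal H w) := fun w => by
    rw [expVal_add]; ring
  simp only [leastSquaresObjective, uniformPOVM_eq, mul_pow, integral_const_mul]
  rw [hXH]
  simp only [e]
  rw [integral_add (integrable_uniformSphere (by fun_prop)) (integrable_uniformSphere (by fun_prop)),
    integral_add (integrable_uniformSphere (by fun_prop)) (integrable_uniformSphere (by fun_prop)),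
    integral_const_mul, hnorm]
  simp only [expVal_add, ← Finset.mul_sum, Finset.sum_add_distrib]
  field_simp
  ring

/-- The integral dominates a positive multiple of `tr H²`, the sum of the squared eigenvalues. This
gives uniqueness of the minimizer. -/
lemma eq_zero_of_integral_expVal_sq {d : ℕ} [NeZero d] {H : Matrix (Fin d) (Fin d) ℂ}
    (hH : H.IsHermitian) (h : ∫ w : ComplexSphere d, expVal H w ^ 2 ∂(uniformSphere d) ≤ 0) :
    H = 0 := by
  have hd : (0 : ℝ) < d := Nat.cast_pos.2 (Nat.pos_of_ne_zero (NeZero.ne d))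
  rw [integral_expVal_sq hH, trace_sq_eq_sum_eigenvalues hH, div_le_iff₀ (by positivity),
    zero_mul] at h
  have hsum : ∑ i, hH.eigenvalues i ^ 2 = 0 :=
    le_antisymm (by nlinarith [sq_nonneg H.trace.re]) (Finset.sum_nonneg fun i _ => sq_nonneg _)
  rw [Finset.sum_eq_zero_iff_of_nonneg fun i _ => sq_nonneg _] at hsum
  rw [← hH.eigenvalues_eq_zero_iff]
  ext i
  exact pow_eq_zero_iff (two_ne_zero) |>.1 (hsum i (Finset.mem_univ i))

/-- The sphere is empty for `d = 0`, so one outcome already forces `d ≥ 1`. -/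
lemma neZero_of_complexSphere {d : ℕ} (v : ComplexSphere d) : NeZero d := by
  refine ⟨?_⟩
  rintro rfl
  have h : ‖(v : EuclideanSpace ℂ (Fin 0))‖ = 1 := norm_eq_of_mem_sphere v
  rw [Subsingleton.elim (v : EuclideanSpace ℂ (Fin 0)) 0, norm_zero] at h
  exact zero_ne_one h

lemma isLeastSquaresEstimator_iff {d n : ℕ} (hn : 0 < n) (v : Fin n → ComplexSphere d)
    (L : Matrix (Fin d) (Fin d) ℂ) : IsLeastSquaresEstimator v L ↔ L = lsEstimate v := by
  have := neZero_of_complexSphere (v ⟨0, hn⟩)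
  have hd : (0 : ℝ) < d := Nat.cast_pos.2 (Nat.pos_of_ne_zero (NeZero.ne d))
  constructor
  · rintro ⟨hL, hmin⟩
    have h := hmin _ (isHermitian_lsEstimate v)
    rw [leastSquaresObjective_eq hn v hL] at h
    refine sub_eq_zero.1 (eq_zero_of_integral_expVal_sq (hL.sub (isHermitian_lsEstimate v)) ?_)
    have hd2 : (0 : ℝ) < d ^ 2 := by positivity
    nlinarith
  · rintro rfl
    refine ⟨isHermitian_lsEstimate v, fun X hX => ?_⟩
    rw [leastSquaresObjective_eq hn v hX]
    have : 0 ≤ ∫ w : ComplexSphere d, expVal (X - lsEstimate v) w ^ 2 ∂(uniformSphere d) :=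
      integral_nonneg fun w => sq_nonneg _
    have := mul_nonneg (sq_nonneg (d : ℝ)) this
    linarith

/-! ### Scalar inequalities for the exponential -/

lemma exp_le_one_add_add_sq_mul_exp_abs (y : ℝ) :
    Real.exp y ≤ 1 + y + y ^ 2 / 2 * Real.exp |y| := by
  rcases le_total 0 y with hy | hy
  · have hmono : MonotoneOn (fun t : ℝ => (1 + t) * Real.exp (-t) + t ^ 2 / 2) (Ici 0) := by
      have hder : ∀ t : ℝ, HasDerivAt (fun t : ℝ => (1 + t) * Real.exp (-t) + t ^ 2 / 2)
          (t * (1 - Real.exp (-t))) t := fun t => by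
        have h1 := ((hasDerivAt_id t).const_add 1).mul ((hasDerivAt_id t).neg.exp)
        have h2 := ((hasDerivAt_id t).pow 2).div_const 2
        refine (h1.add h2).congr_deriv ?_
        simp
        ring
      refine monotoneOn_of_deriv_nonneg (convex_Ici 0)
        (fun t _ => (hder t).continuousAt.continuousWithinAt)
        (fun t _ => (hder t).differentiableAt.differentiableWithinAt) fun t ht => ?_
      rw [interior_Ici, mem_Ioi] at ht
      rw [(hder t).deriv]
      exact mul_nonneg ht.le (by simpa using ht.le)
    have h := hmono (mem_Ici.2 le_rfl) (mem_Ici.2 hy) hy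
    simp only [add_zero, neg_zero, Real.exp_zero, mul_one] at h
    rw [abs_of_nonneg hy]
    have hm := mul_le_mul_of_nonneg_right h (Real.exp_pos y).le
    have he : Real.exp (-y) * Real.exp y = 1 := by rw [← Real.exp_add]; simp
    have : ((1 + y) * Real.exp (-y) + y ^ 2 / 2) * Real.exp y =
        1 + y + y ^ 2 / 2 * Real.exp y := by linear_combination (1 + y) * he
    rw [this] at hm
    simpa using hm
  · have hanti : AntitoneOn (fun t : ℝ => 1 + t + t ^ 2 / 2 - Real.exp t) (Iic 0) := by
      have hder : ∀ t : ℝ, HasDerivAt (fun t : ℝ => 1 + t + t ^ 2 / 2 - Real.exp t)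
          (1 + t - Real.exp t) t := fun t => by
        have h1 := ((hasDerivAt_id t).const_add 1).add (((hasDerivAt_id t).pow 2).div_const 2)
        refine (h1.sub (Real.hasDerivAt_exp t)).congr_deriv ?_
        simp
      refine antitoneOn_of_deriv_nonpos (convex_Iic 0)
        (fun t _ => (hder t).continuousAt.continuousWithinAt)
        (fun t _ => (hder t).differentiableAt.differentiableWithinAt) fun t _ => ?_
      rw [(hder t).deriv]
      linarith [Real.add_one_le_exp t]
    have h := hanti (mem_Iic.2 hy) (mem_Iic.2 le_rfl) hy
    simp only [add_zero, Real.exp_zero] at h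
    have h1 : 1 ≤ Real.exp |y| := Real.one_le_exp (abs_nonneg y)
    nlinarith [sq_nonneg y]

/-- Turns the second-order Taylor remainder of a deviation `y` into an exponential of the overlap
`x`. The rate `1/3` leaves `exp(2x/3)` after squaring, still integrable uniformly in `d`. -/
lemma sq_mul_exp_le {x y : ℝ} (hy : 0 ≤ y) (hyx : y ≤ 2 + x) :
    y ^ 2 / 2 * Real.exp (y / 120) ≤ 9 * Real.exp (x / 3) := by
  have h1 : y / 8 ≤ Real.exp (y / 8 - 1) := by linarith [Real.add_one_le_exp (y / 8 - 1)]
  have h2 : y ^ 2 ≤ 64 * Real.exp (y / 4 - 2) := by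
    have h3 := pow_le_pow_left₀ (by positivity) h1 2
    rw [← Real.exp_nat_mul] at h3
    have : ((2 : ℕ) : ℝ) * (y / 8 - 1) = y / 4 - 2 := by push_cast; ring
    rw [this] at h3
    linarith
  have h4 : Real.exp (-(4 / 3)) ≤ 9 / 32 := by
    rw [Real.exp_neg, inv_le_comm₀ (Real.exp_pos _) (by norm_num)]
    have h5 : Real.exp (4 / 3) ^ 3 = Real.exp 1 ^ 4 := by
      rw [← Real.exp_nat_mul, ← Real.exp_nat_mul]; norm_num
    by_contra hlt
    rw [not_le] at hlt
    have h6 := pow_lt_pow_left₀ hlt (Real.exp_pos _).le (n := 3) (by norm_num)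
    have h7 : (2.7 : ℝ) ^ 4 ≤ Real.exp 1 ^ 4 :=
      pow_le_pow_left₀ (by norm_num) (by linarith [Real.exp_one_gt_d9]) 4
    rw [h5] at h6
    norm_num at h6 h7
    linarith
  calc y ^ 2 / 2 * Real.exp (y / 120)
      ≤ 32 * Real.exp (y / 4 - 2) * Real.exp (y / 120) := by
        gcongr; linarith
    _ = 32 * Real.exp (y / 4 - 2 + y / 120) := by rw [mul_assoc, ← Real.exp_add]
    -- The exponent is `31y/120 - 2`. Bounding `y` by `2 + x` leaves a slack of `(3/40)(x + 2)`,
    -- which is nonnegative as `0 ≤ y ≤ 2 + x`.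
    _ ≤ 32 * Real.exp (x / 3 + -(4 / 3)) :=
        mul_le_mul_of_nonneg_left (Real.exp_le_exp.2 (by linarith)) (by norm_num)
    _ = 32 * Real.exp (-(4 / 3)) * Real.exp (x / 3) := by rw [Real.exp_add]; ring
    _ ≤ 9 * Real.exp (x / 3) := by gcongr; linarith

/-! ### Deviations under the Born law -/

variable {d : ℕ} {ρ : Matrix (Fin d) (Fin d) ℂ}

lemma IsQuantumState.sum_eigenvalues (hρ : IsQuantumState ρ) :
    ∑ i, hρ.1.isHermitian.eigenvalues i = 1 := by
  have h := congrArg Complex.re (hρ.2.symm.trans hρ.1.isHermitian.trace_eq_sum_eigenvalues)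
  simpa using h.symm

lemma IsQuantumState.eigenvalues_le_one (hρ : IsQuantumState ρ) (i : Fin d) :
    hρ.1.isHermitian.eigenvalues i ≤ 1 := by
  rw [← hρ.sum_eigenvalues]
  exact Finset.single_le_sum (fun j _ => hρ.1.eigenvalues_nonneg j) (Finset.mem_univ i)

lemma IsQuantumState.expVal_nonneg (hρ : IsQuantumState ρ) (v : EuclideanSpace ℂ (Fin d)) :
    0 ≤ expVal ρ v := by
  rw [expVal_eq_sum_eigenvalues hρ.1.isHermitian]
  exact Finset.sum_nonneg fun i _ => mul_nonneg (hρ.1.eigenvalues_nonneg i) (sq_nonneg _)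

lemma IsQuantumState.expVal_le_one (hρ : IsQuantumState ρ) {z : EuclideanSpace ℂ (Fin d)}
    (hz : ‖z‖ = 1) : expVal ρ z ≤ 1 := by
  rw [expVal_eq_sum_eigenvalues hρ.1.isHermitian]
  calc _ ≤ ∑ i, 1 * ‖inner ℂ (hρ.1.isHermitian.eigenvectorBasis i) z‖ ^ 2 := by
        gcongr with i
        exact hρ.eigenvalues_le_one i
    _ = 1 := by
      simp only [one_mul]
      rw [OrthonormalBasis.sum_sq_norm_inner_right, hz, one_pow]

lemma IsQuantumState.trace_re (hρ : IsQuantumState ρ) : ρ.trace.re = 1 := by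
  rw [hρ.2, Complex.one_re]

lemma IsQuantumState.trace_sq_le_one (hρ : IsQuantumState ρ) : (ρ * ρ).trace.re ≤ 1 := by
  rw [trace_sq_eq_sum_eigenvalues hρ.1.isHermitian, ← hρ.sum_eigenvalues]
  gcongr with i
  nlinarith [hρ.1.eigenvalues_nonneg i, hρ.eigenvalues_le_one i]

lemma IsQuantumState.neZero (hρ : IsQuantumState ρ) : NeZero d := by
  refine ⟨?_⟩
  rintro rfl
  have := hρ.2
  simp [Matrix.trace] at this

lemma integral_bornLaw (hρ : IsQuantumState ρ) (f : ComplexSphere d → ℝ) :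
    ∫ v, f v ∂(bornLaw ρ) = ∫ v : ComplexSphere d, d * expVal ρ v * f v ∂(uniformSphere d) := by
  have hm : Measurable fun v : ComplexSphere d => ENNReal.ofReal (uniformPOVM ρ v) := by
    simp only [uniformPOVM_eq]
    fun_prop
  rw [bornLaw, integral_withDensity_eq_integral_toReal_smul hm
    (ae_of_all _ fun _ => ENNReal.ofReal_lt_top)]
  refine integral_congr_ae (ae_of_all _ fun v => ?_)
  simp only [uniformPOVM_eq, smul_eq_mul]
  rw [ENNReal.toReal_ofReal (mul_nonneg (Nat.cast_nonneg _) (hρ.expVal_nonneg _))]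

/-- The centred contribution of the outcome `v` to `⟨z|L - ρ|z⟩`. -/
def deviation (ρ : Matrix (Fin d) (Fin d) ℂ) (z v : EuclideanSpace ℂ (Fin d)) : ℝ :=
  (d + 1) * ‖inner ℂ z v‖ ^ 2 - 1 - expVal ρ z

lemma abs_deviation_le (hρ : IsQuantumState ρ) {z v : EuclideanSpace ℂ (Fin d)} (hz : ‖z‖ = 1)
    (hv : ‖v‖ = 1) : |deviation ρ z v| ≤ 2 + d * ‖inner ℂ z v‖ ^ 2 := by
  have h1 := hρ.expVal_nonneg z
  have h2 := hρ.expVal_le_one hz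
  have h3 : ‖inner ℂ z v‖ ≤ 1 := by simpa [hz, hv] using norm_inner_le_norm (𝕜 := ℂ) z v
  have h4 : ‖inner ℂ z v‖ ^ 2 ≤ 1 := pow_le_one₀ (norm_nonneg _) h3
  have h5 : 0 ≤ (d : ℝ) * ‖inner ℂ z v‖ ^ 2 := by positivity
  rw [deviation, abs_le]
  constructor <;> nlinarith [sq_nonneg ‖inner ℂ z v‖]

lemma integral_born_one [NeZero d] (hρ : IsQuantumState ρ) :
    ∫ v : ComplexSphere d, d * expVal ρ v ∂(uniformSphere d) = 1 := by
  have h := integral_expVal_mul_expVal hρ.1.isHermitian Matrix.isHermitian_one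
  simp only [expVal_one, norm_eq_of_mem_sphere, one_pow, mul_one, Matrix.trace_one, hρ.trace_re,
    Fintype.card_fin, Complex.natCast_re, one_mul] at h
  rw [integral_const_mul, h]
  have hd : (d : ℝ) ≠ 0 := Nat.cast_ne_zero.2 (NeZero.ne d)
  field_simp

/-- Unbiasedness of the estimator: the second-moment formula for `ρ` and `outer z` gives the mean
overlap `(1 + ⟨z|ρ|z⟩) / (d + 1)`. -/
lemma integral_born_deviation [NeZero d] (hρ : IsQuantumState ρ)
    {z : EuclideanSpace ℂ (Fin d)} (hz : ‖z‖ = 1) :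
    ∫ v : ComplexSphere d, d * expVal ρ v * deviation ρ z v ∂(uniformSphere d) = 0 := by
  have h := integral_expVal_mul_expVal hρ.1.isHermitian (isHermitian_outer z)
  rw [hρ.trace_re, trace_outer, trace_mul_outer, hz] at h
  have h1 := integral_born_one hρ
  have e : ∀ v : ComplexSphere d, d * expVal ρ v * deviation ρ z v =
      d * (d + 1) * (expVal ρ v * expVal (outer z) v) - (1 + expVal ρ z) * (d * expVal ρ v) :=
    fun v => by rw [deviation, expVal_outer]; ring
  simp only [e]
  rw [integral_sub (integrable_uniformSphere (by fun_prop)) (integrable_uniformSphere (by fun_prop)),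
    integral_const_mul, integral_const_mul (1 + expVal ρ z), h, h1]
  have hd : (d : ℝ) ≠ 0 := Nat.cast_ne_zero.2 (NeZero.ne d)
  field_simp
  ring

/-- The integral is `d(1 + tr ρ²)/(d + 1)`, and `tr ρ² ≤ 1`. The dimension-free bound allows the
Born weight to be split off by AM-GM. -/
lemma integral_born_sq_le [NeZero d] (hρ : IsQuantumState ρ) :
    ∫ v : ComplexSphere d, (d * expVal ρ v) ^ 2 ∂(uniformSphere d) ≤ 2 := by
  have hd : (0 : ℝ) < d := Nat.cast_pos.2 (Nat.pos_of_ne_zero (NeZero.ne d))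
  simp only [mul_pow]
  rw [integral_const_mul, integral_expVal_sq hρ.1.isHermitian, hρ.trace_re, ← mul_div_assoc,
    div_le_iff₀ (by positivity)]
  nlinarith [mul_le_mul_of_nonneg_left hρ.trace_sq_le_one (sq_nonneg (d : ℝ))]

/-- The deviation has sub-Gaussian exponential moments near the origin. -/
lemma integral_born_exp_deviation_le [NeZero d] (hρ : IsQuantumState ρ)
    {z : EuclideanSpace ℂ (Fin d)} (hz : ‖z‖ = 1) {t : ℝ} (ht : |t| ≤ 1 / 120) :
    ∫ v : ComplexSphere d, Real.exp (t * deviation ρ z v) ∂(bornLaw ρ) ≤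
      Real.exp (30 * t ^ 2) := by
  have hd : (0 : ℝ) < d := Nat.cast_pos.2 (Nat.pos_of_ne_zero (NeZero.ne d))
  have hdev : Continuous fun v : ComplexSphere d => deviation ρ z v := by
    unfold deviation; fun_prop
  have hpt : ∀ v : ComplexSphere d, d * expVal ρ v * Real.exp (t * deviation ρ z v) ≤
      d * expVal ρ v + t * (d * expVal ρ v * deviation ρ z v) +
        t ^ 2 * (11 / 2 * (d * expVal ρ v) ^ 2 + 81 / 22 *
          Real.exp (2 / 3 * (d * ‖inner ℂ z (v : EuclideanSpace ℂ (Fin d))‖ ^ 2))) := by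
    intro v
    set Y := deviation ρ z v
    set x := (d : ℝ) * ‖inner ℂ z (v : EuclideanSpace ℂ (Fin d))‖ ^ 2
    set q := (d : ℝ) * expVal ρ v
    have hq : 0 ≤ q := mul_nonneg hd.le (hρ.expVal_nonneg _)
    have h1 := exp_le_one_add_add_sq_mul_exp_abs (t * Y)
    have h2 := sq_mul_exp_le (abs_nonneg Y)
      (abs_deviation_le hρ hz (norm_eq_of_mem_sphere v))
    have h3 : Real.exp |t * Y| ≤ Real.exp (|Y| / 120) := by
      rw [abs_mul]
      gcongr
      nlinarith [abs_nonneg Y]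
    have h4 : (t * Y) ^ 2 / 2 * Real.exp |t * Y| ≤ t ^ 2 * (9 * Real.exp (x / 3)) := by
      calc _ ≤ (t * Y) ^ 2 / 2 * Real.exp (|Y| / 120) := by gcongr
        _ = t ^ 2 * (|Y| ^ 2 / 2 * Real.exp (|Y| / 120)) := by rw [sq_abs]; ring
        _ ≤ _ := by gcongr
    -- AM-GM from `(11q - 9e^(x/3))² ≥ 0`. The weights balance the two integrals, bounded by 2 and
    -- by `(1 - 2/3)⁻¹ = 3`: the contributions are 11 and `243/22`, together below 30.
    have h5 : q * (9 * Real.exp (x / 3)) ≤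
        11 / 2 * q ^ 2 + 81 / 22 * Real.exp (2 / 3 * x) := by
      have : Real.exp (2 / 3 * x) = Real.exp (x / 3) ^ 2 := by
        rw [← Real.exp_nat_mul]; congr 1; push_cast; ring
      rw [this]
      nlinarith [sq_nonneg (11 * q - 9 * Real.exp (x / 3))]
    calc q * Real.exp (t * Y) ≤ q * (1 + t * Y + t ^ 2 * (9 * Real.exp (x / 3))) := by
          gcongr; linarith
      _ = q + t * (q * Y) + t ^ 2 * (q * (9 * Real.exp (x / 3))) := by ring
      _ ≤ _ := by gcongr
  rw [integral_bornLaw hρ]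
  calc _ ≤ ∫ v : ComplexSphere d, (d * expVal ρ v + t * (d * expVal ρ v * deviation ρ z v) +
        t ^ 2 * (11 / 2 * (d * expVal ρ v) ^ 2 + 81 / 22 *
          Real.exp (2 / 3 * (d * ‖inner ℂ z (v : EuclideanSpace ℂ (Fin d))‖ ^ 2))))
          ∂(uniformSphere d) :=
        integral_mono (integrable_uniformSphere (by fun_prop))
          (integrable_uniformSphere (by fun_prop)) hpt
    _ ≤ 1 + 30 * t ^ 2 := by
        rw [integral_add (integrable_uniformSphere (by fun_prop))
          (integrable_uniformSphere (by fun_prop)),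
          integral_add (integrable_uniformSphere (by fun_prop))
          (integrable_uniformSphere (by fun_prop)), integral_const_mul t,
          integral_const_mul (t ^ 2), integral_add (integrable_uniformSphere (by fun_prop))
          (integrable_uniformSphere (by fun_prop)), integral_const_mul (11 / 2),
          integral_const_mul (81 / 22), integral_born_one hρ, integral_born_deviation hρ hz]
        have h1 := integral_born_sq_le hρ
        have h2 := integral_exp_overlap_le hz (s := 2 / 3) (by norm_num)
        nlinarith [sq_nonneg t]
    _ ≤ Real.exp (30 * t ^ 2) := by linarith [Real.add_one_le_exp (30 * t ^ 2)]

/-! ### From the operator norm to averages over the sphere -/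

lemma opNorm_le_of_abs_eigenvalues_le {d : ℕ} {A : Matrix (Fin d) (Fin d) ℂ} (hA : A.IsHermitian)
    {M : ℝ} (hM : 0 ≤ M) (h : ∀ i, |hA.eigenvalues i| ≤ M) : opNorm A ≤ M := by
  refine ContinuousLinearMap.opNorm_le_bound _ hM fun v => ?_
  refine le_of_sq_le_sq ?_ (by positivity)
  rw [mul_pow, ← hA.eigenvectorBasis.sum_sq_norm_inner_right,
    ← hA.eigenvectorBasis.sum_sq_norm_inner_right v, Finset.mul_sum]
  gcongr with i
  rw [toEuclideanCLM_eq_sum_eigenvalues hA, hA.eigenvectorBasis.orthonormal.inner_right_fintype,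
    norm_mul, mul_pow, mul_comm, Complex.norm_real, Real.norm_eq_abs]
  gcongr
  exact h i

/-- Near an extremal eigenvector, a Hermitian matrix has expectation values of the order of its
operator norm. -/
lemma exists_cap_expVal_ge {d : ℕ} [NeZero d] {A : Matrix (Fin d) (Fin d) ℂ}
    (hA : A.IsHermitian) :
    ∃ x : EuclideanSpace ℂ (Fin d), ‖x‖ = 1 ∧ ∃ ε : ℝ, (ε = 1 ∨ ε = -1) ∧
      ∀ z : EuclideanSpace ℂ (Fin d), ‖z‖ = 1 → 3 / 4 ≤ ‖inner ℂ x z‖ ^ 2 →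
        opNorm A / 2 ≤ ε * expVal A z := by
  obtain ⟨k, -, hk⟩ := Finset.exists_max_image Finset.univ (fun i => |hA.eigenvalues i|)
    ⟨0, Finset.mem_univ _⟩
  have hop := opNorm_le_of_abs_eigenvalues_le hA (abs_nonneg (hA.eigenvalues k))
    fun i => hk i (Finset.mem_univ i)
  obtain ⟨ε, hε, hεk⟩ : ∃ ε : ℝ, (ε = 1 ∨ ε = -1) ∧ ε * hA.eigenvalues k = |hA.eigenvalues k| := by
    rcases le_total 0 (hA.eigenvalues k) with h | h
    · exact ⟨1, .inl rfl, by rw [abs_of_nonneg h, one_mul]⟩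
    · exact ⟨-1, .inr rfl, by rw [abs_of_nonpos h, neg_one_mul]⟩
  refine ⟨hA.eigenvectorBasis k, hA.eigenvectorBasis.norm_eq_one k, ε, hε, fun z hz hzk => ?_⟩
  have hsum := hA.eigenvectorBasis.sum_sq_norm_inner_right z
  set M := |hA.eigenvalues k|
  -- Every eigenvalue other than the `k`-th is bounded below by its worst case `-M`. Summation gives
  -- `-M + 2M · 3/4 = M/2`.
  have hle : ∀ i, -M * ‖inner ℂ (hA.eigenvectorBasis i) z‖ ^ 2 +
      (if i = k then 2 * M * ‖inner ℂ (hA.eigenvectorBasis k) z‖ ^ 2 else 0) ≤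
      ε * (hA.eigenvalues i * ‖inner ℂ (hA.eigenvectorBasis i) z‖ ^ 2) := by
    intro i
    rw [← mul_assoc]
    split_ifs with hik
    · subst hik
      rw [hεk]
      apply le_of_eq; ring
    · rw [add_zero]
      gcongr
      have h1 := hk i (Finset.mem_univ i)
      have h2 : |ε * hA.eigenvalues i| = |hA.eigenvalues i| := by
        rcases hε with rfl | rfl <;> simp
      have h3 := neg_abs_le (ε * hA.eigenvalues i)
      linarith
  have hfin := Finset.sum_le_sum fun i (_ : i ∈ Finset.univ) => hle i
  rw [Finset.sum_add_distrib, ← Finset.mul_sum, ← Finset.mul_sum, hsum, hz, Finset.sum_ite_eq',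
    if_pos (Finset.mem_univ k), ← expVal_eq_sum_eigenvalues hA] at hfin
  nlinarith [abs_nonneg (hA.eigenvalues k)]

/-- The cap around an extremal eigenvector alone contributes this much to the integral. This
replaces a net: a large operator norm is detected by one average for each sign. -/
lemma exists_sign_integral_exp_expVal_ge {d : ℕ} [NeZero d] {A : Matrix (Fin d) (Fin d) ℂ}
    (hA : A.IsHermitian) {a τ : ℝ} (ha : 0 ≤ a) (hτ : τ ≤ opNorm A) :
    ∃ ε : ℝ, (ε = 1 ∨ ε = -1) ∧ (1 / 9) ^ d * Real.exp (a * (τ / 2)) ≤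
      ∫ z : ComplexSphere d, Real.exp (a * (ε * expVal A z)) ∂(uniformSphere d) := by
  obtain ⟨x, hx, ε, hε, h⟩ := exists_cap_expVal_ge hA
  refine ⟨ε, hε, ?_⟩
  have hint : Integrable (fun z : ComplexSphere d => Real.exp (a * (ε * expVal A z)))
      (uniformSphere d) := integrable_uniformSphere (by fun_prop)
  have hmarkov := mul_meas_ge_le_integral_of_nonneg
    (ae_of_all _ fun z => (Real.exp_pos _).le) hint (Real.exp (a * (τ / 2)))
  have hsub := measureReal_mono (μ := uniformSphere d) (s₂ := {z : ComplexSphere d |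
    Real.exp (a * (τ / 2)) ≤ Real.exp (a * (ε * expVal A z))}) (fun z (hz : _ ≤ _) => by
      have := h z (norm_eq_of_mem_sphere z) hz
      refine Real.exp_le_exp.2 ?_
      gcongr
      linarith)
  calc _ ≤ Real.exp (a * (τ / 2)) * (uniformSphere d).real _ := by
        rw [mul_comm]
        exact mul_le_mul_of_nonneg_left ((cap_measure_ge hx).trans hsub) (Real.exp_pos _).le
    _ ≤ _ := hmarkov

/-! ### Tail bound and sample complexity -/

section Sample

variable {d n : ℕ} {ρ : Matrix (Fin d) (Fin d) ℂ} {Ω : Type*} [MeasurableSpace Ω] {P : Measure Ω}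
  {V : Fin n → Ω → ComplexSphere d}

lemma IsUniformPOVMSample.integral_exp_sum_deviation_le [NeZero d] (hρ : IsQuantumState ρ)
    (hV : IsUniformPOVMSample ρ P V) {z : EuclideanSpace ℂ (Fin d)} (hz : ‖z‖ = 1) {t : ℝ}
    (ht : |t| ≤ 1 / 120) :
    ∫ ω, Real.exp (t * ∑ i, deviation ρ z (V i ω)) ∂P ≤ Real.exp (30 * t ^ 2) ^ n := by
  have hcont : Continuous fun v : ComplexSphere d => deviation ρ z v := by
    unfold deviation; fun_prop
  have hindep : iIndepFun (fun i ω => deviation ρ z (V i ω)) P :=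
    hV.indep.comp (fun _ (v : ComplexSphere d) => deviation ρ z v) fun _ => hcont.measurable
  have h := hindep.mgf_sum (t := t) (fun i => hcont.measurable.comp (hV.measurable i)) Finset.univ
  simp only [mgf, Finset.sum_apply] at h
  rw [h]
  calc _ ≤ ∏ _i : Fin n, Real.exp (30 * t ^ 2) := by
        refine Finset.prod_le_prod (fun i _ => integral_nonneg fun ω => (Real.exp_pos _).le)
          fun i _ => ?_
        refine le_trans (le_of_eq ?_) (integral_born_exp_deviation_le hρ hz ht)
        rw [← hV.law i, integral_map (hV.measurable i).aemeasurable]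
        exact (by fun_prop : Continuous fun v : ComplexSphere d =>
          Real.exp (t * deviation ρ z v)).aestronglyMeasurable
    _ = _ := by simp

lemma continuous_exp_sum_deviation (t : ℝ) :
    Continuous fun p : (Fin n → ComplexSphere d) × ComplexSphere d =>
      Real.exp (t * ∑ i, deviation ρ p.2 (p.1 i)) := by
  unfold deviation; fun_prop

/-- A continuous function of the outcomes and of an independent uniform state is integrable. -/
lemma IsUniformPOVMSample.integrable_comp [IsProbabilityMeasure P] [NeZero d]
    (hV : IsUniformPOVMSample ρ P V) {g : (Fin n → ComplexSphere d) × ComplexSphere d → ℝ}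
    (hg : Continuous g) :
    Integrable (fun p : Ω × ComplexSphere d => g (fun i => V i p.1, p.2))
      (P.prod (uniformSphere d)) := by
  obtain ⟨C, hC⟩ := isCompact_univ.exists_bound_of_continuousOn hg.continuousOn
  have hm : Measurable fun p : Ω × ComplexSphere d => ((fun i => V i p.1, p.2) :
      (Fin n → ComplexSphere d) × ComplexSphere d) :=
    (measurable_pi_lambda _ fun i => (hV.measurable i).comp measurable_fst).prodMk measurable_snd
  exact Integrable.of_bound (hg.measurable.comp hm).aestronglyMeasurable C
    (ae_of_all _ fun p => hC _ (mem_univ _))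

lemma IsUniformPOVMSample.integrable_exp_sum_deviation [IsProbabilityMeasure P] [NeZero d]
    (hV : IsUniformPOVMSample ρ P V) (t : ℝ) :
    Integrable (Function.uncurry fun (ω : Ω) (z : ComplexSphere d) =>
      Real.exp (t * ∑ i, deviation ρ z (V i ω))) (P.prod (uniformSphere d)) :=
  hV.integrable_comp (continuous_exp_sum_deviation (ρ := ρ) t)

lemma IsUniformPOVMSample.integral_integral_exp_le [IsProbabilityMeasure P] [NeZero d] (hρ : IsQuantumState ρ)
    (hV : IsUniformPOVMSample ρ P V) {t : ℝ} (ht : |t| ≤ 1 / 120) :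
    ∫ ω, ∫ z : ComplexSphere d, Real.exp (t * ∑ i, deviation ρ z (V i ω))
      ∂(uniformSphere d) ∂P ≤ Real.exp (30 * t ^ 2) ^ n := by
  have hint := hV.integrable_exp_sum_deviation t
  rw [integral_integral_swap hint]
  calc _ ≤ ∫ _z : ComplexSphere d, Real.exp (30 * t ^ 2) ^ n ∂(uniformSphere d) :=
        integral_mono hint.integral_prod_right (integrable_const _) fun z =>
          hV.integral_exp_sum_deviation_le hρ (norm_eq_of_mem_sphere z) ht
    _ = _ := by simp

lemma nat_mul_expVal_lsEstimate_sub (hn : 0 < n) (v : Fin n → ComplexSphere d)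
    (z : ComplexSphere d) :
    n * expVal (lsEstimate v - ρ) z = ∑ i, deviation ρ z (v i) := by
  have hn' : (n : ℝ) ≠ 0 := by positivity
  rw [expVal_sub, expVal_lsEstimate]
  simp only [deviation, Finset.sum_sub_distrib, ← Finset.mul_sum, Finset.sum_const,
    Finset.card_univ, Fintype.card_fin, nsmul_eq_mul]
  field_simp

/-- The tail bound for the least-squares estimator. -/
lemma IsUniformPOVMSample.measure_opNorm_ge_le [IsProbabilityMeasure P] (hn : 0 < n) (hρ : IsQuantumState ρ)
    (hV : IsUniformPOVMSample ρ P V) {τ : ℝ} (h0 : 0 ≤ τ) (h1 : τ ≤ 1) :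
    P.real {ω | τ ≤ opNorm (lsEstimate (fun i => V i ω) - ρ)} ≤
      2 * Real.exp (2 * Real.log 3 * (d : ℝ) - 1 / 480 * (n : ℝ) * τ ^ 2) := by
  have := hρ.neZero
  -- The choice `t = τ/120` minimizes `30t² - tτ/2`, with minimum `-τ²/480`; `τ ≤ 1` keeps it in the
  -- range where the moment bound holds.
  obtain ⟨c, hcdef⟩ : ∃ c : ℝ, c = (1 / 9) ^ d * Real.exp (τ / 120 * n * (τ / 2)) := ⟨_, rfl⟩
  have hc : 0 < c := by rw [hcdef]; positivity
  let G : ℝ → Ω → ℝ := fun t ω => ∫ z : ComplexSphere d,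
    Real.exp (t * ∑ i, deviation ρ z (V i ω)) ∂(uniformSphere d)
  have hG : ∀ t : ℝ, |t| = τ / 120 → P.real {ω | c ≤ G t ω} ≤
      Real.exp (2 * Real.log 3 * (d : ℝ) - 1 / 480 * (n : ℝ) * τ ^ 2) := by
    intro t ht
    have hmarkov := mul_meas_ge_le_integral_of_nonneg (μ := P) (f := G t)
      (ae_of_all _ fun ω => integral_nonneg fun z => (Real.exp_pos _).le)
      (hV.integrable_exp_sum_deviation t).integral_prod_left c
    have hle := hmarkov.trans (hV.integral_integral_exp_le hρ (t := t) (by rw [ht]; linarith))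
    rw [mul_comm, ← le_div_iff₀ hc] at hle
    refine hle.trans (le_of_eq ?_)
    have h9 : (1 / 9 : ℝ) ^ d = Real.exp (-(2 * Real.log 3 * d)) := by
      rw [← Real.exp_log (by norm_num : (0 : ℝ) < 1 / 9), ← Real.exp_nat_mul, one_div,
        Real.log_inv, (by norm_num : (9 : ℝ) = 3 ^ 2), Real.log_pow]
      congr 1
      push_cast
      ring
    rw [div_eq_iff hc.ne', hcdef, h9, ← Real.exp_add, ← Real.exp_add, ← Real.exp_nat_mul,
      ← sq_abs, ht]
    congr 1
    ring
  have hsub : {ω | τ ≤ opNorm (lsEstimate (fun i => V i ω) - ρ)} ⊆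
      {ω | c ≤ G (τ / 120) ω} ∪ {ω | c ≤ G (-(τ / 120)) ω} := by
    intro ω hω
    obtain ⟨ε, hε, h⟩ := exists_sign_integral_exp_expVal_ge
      ((isHermitian_lsEstimate fun i => V i ω).sub hρ.1.isHermitian)
      (a := τ / 120 * n) (by positivity) hω
    have he : ∀ z : ComplexSphere d, τ / 120 * n *
        (ε * expVal (lsEstimate (fun i => V i ω) - ρ) z) =
        ε * (τ / 120) * ∑ i, deviation ρ z (V i ω) := fun z => by
      rw [← nat_mul_expVal_lsEstimate_sub hn]; ring
    simp only [he, ← hcdef] at h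
    rcases hε with rfl | rfl
    · left
      rwa [one_mul] at h
    · right
      rwa [neg_one_mul] at h
  calc _ ≤ P.real ({ω | c ≤ G (τ / 120) ω} ∪ {ω | c ≤ G (-(τ / 120)) ω}) := measureReal_mono hsub
    _ ≤ _ := measureReal_union_le _ _
    _ ≤ _ := by
      have e1 := hG (τ / 120) (abs_of_nonneg (by positivity))
      have e2 := hG (-(τ / 120)) (by rw [abs_neg, abs_of_nonneg (by positivity)])
      linarith

/-- The sample complexity of the least-squares estimator. -/
lemma IsUniformPOVMSample.le_measure_opNorm_le [IsProbabilityMeasure P] (hρ : IsQuantumState ρ)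
    (hV : IsUniformPOVMSample ρ P V) {δ₀ τ δ : ℝ} (hδ₀ : δ₀ < 1) (h0 : 0 < τ) (h1 : τ ≤ 1)
    (hδ : 0 < δ) (hδδ : δ ≤ δ₀)
    (h : 480 * ((2 * Real.log 3 + Real.log 2) / Real.log (1 / δ₀) + 1) * (d / τ ^ 2) *
      Real.log (1 / δ) ≤ n) :
    1 - δ ≤ P.real {ω | opNorm (lsEstimate (fun i => V i ω) - ρ) ≤ τ} := by
  have hdz := hρ.neZero
  have hd : (1 : ℝ) ≤ d := Nat.one_le_cast.2 (Nat.pos_of_ne_zero (NeZero.ne d))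
  have hl3 : 0 < Real.log 3 := Real.log_pos (by norm_num)
  have hl2 : 0 < Real.log 2 := Real.log_pos (by norm_num)
  have hl0 : 0 < Real.log (1 / δ₀) := Real.log_pos (by
    rw [lt_div_iff₀ (hδ.trans_le hδδ)]; linarith)
  have hll : Real.log (1 / δ₀) ≤ Real.log (1 / δ) :=
    Real.log_le_log (by have := hδ.trans_le hδδ; positivity) (by gcongr)
  set l₀ := Real.log (1 / δ₀)
  set l := Real.log (1 / δ) with hl
  set κ := 2 * Real.log 3 + Real.log 2 with hκ
  have hlpos : 0 < l := hl0.trans_le hll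
  have hn : 0 < n := by
    rw [← Nat.cast_pos (α := ℝ)]
    refine lt_of_lt_of_le ?_ h
    positivity
  -- As `l/l₀ ≥ 1`, the dimension term `κd` can be charged to `log(1/δ)`; this is where `C` depends
  -- on `δ₀`. The summand `log 2` of `κ` pays for the prefactor 2, using `d ≥ 1`.
  have hkey : κ * d + l ≤ 1 / 480 * n * τ ^ 2 := by
    have h2 : 480 * (κ / l₀ + 1) * (d / τ ^ 2) * l * (τ ^ 2 / 480) ≤ n * (τ ^ 2 / 480) := by
      gcongr
    have h3 : 480 * (κ / l₀ + 1) * (d / τ ^ 2) * l * (τ ^ 2 / 480) =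
        κ * d * (l / l₀) + d * l := by
      field_simp
    have h4 : 1 ≤ l / l₀ := (one_le_div hl0).2 hll
    have h5 : κ * d ≤ κ * d * (l / l₀) := le_mul_of_one_le_right (by positivity) h4
    have h6 : l ≤ d * l := le_mul_of_one_le_left hlpos.le hd
    rw [h3] at h2
    linarith
  have htail := hV.measure_opNorm_ge_le hn hρ h0.le h1
  have hexp : 2 * Real.exp (2 * Real.log 3 * (d : ℝ) - 1 / 480 * (n : ℝ) * τ ^ 2) ≤ δ := by
    calc _ = Real.exp (Real.log 2 + (2 * Real.log 3 * (d : ℝ) - 1 / 480 * (n : ℝ) * τ ^ 2)) := by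
          rw [Real.exp_add, Real.exp_log (by norm_num)]
      _ ≤ Real.exp (-l) := by
          refine Real.exp_le_exp.2 ?_
          have : Real.log 2 ≤ Real.log 2 * d := le_mul_of_one_le_right hl2.le hd
          rw [hκ] at hkey
          linarith
      _ = δ := by rw [hl, one_div, Real.log_inv, neg_neg, Real.exp_log hδ]
  have hunion : (univ : Set Ω) ⊆ {ω | opNorm (lsEstimate (fun i => V i ω) - ρ) ≤ τ} ∪
      {ω | τ ≤ opNorm (lsEstimate (fun i => V i ω) - ρ)} :=
    fun ω _ => le_total (opNorm (lsEstimate (fun i => V i ω) - ρ)) τ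
  have h7 := (measureReal_mono (μ := P) hunion).trans (measureReal_union_le _ _)
  rw [probReal_univ] at h7
  linarith

end Sample

end

theorem mainTheorem5 :
    -- the least-squares estimator is well defined
    (∀ (d n : ℕ), 0 < n → ∀ v : Fin n → ComplexSphere d,
      ∃! L : Matrix (Fin d) (Fin d) ℂ, IsLeastSquaresEstimator v L) ∧
    -- the tail bound
    (∀ (d n : ℕ), 0 < n → ∀ ρ : Matrix (Fin d) (Fin d) ℂ, IsQuantumState ρ →
      ∀ (Ω : Type*) [MeasurableSpace Ω] (P : Measure Ω) [IsProbabilityMeasure P]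
        (V : Fin n → Ω → ComplexSphere d), IsUniformPOVMSample ρ P V →
      ∀ L : Ω → Matrix (Fin d) (Fin d) ℂ,
        (∀ ω, IsLeastSquaresEstimator (fun i => V i ω) (L ω)) →
      ∀ τ : ℝ, 0 ≤ τ → τ ≤ 1 →
        P.real {ω | τ ≤ opNorm (L ω - ρ)} ≤
          2 * Real.exp (2 * Real.log 3 * (d : ℝ) - 1 / 480 * (n : ℝ) * τ ^ 2)) ∧
    -- the sample complexity
    (∀ δ₀ : ℝ, 0 < δ₀ → δ₀ < 1 → ∃ C : ℝ, 0 < C ∧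
      ∀ (d n : ℕ) (ρ : Matrix (Fin d) (Fin d) ℂ), IsQuantumState ρ →
      ∀ (Ω : Type*) [MeasurableSpace Ω] (P : Measure Ω) [IsProbabilityMeasure P]
        (V : Fin n → Ω → ComplexSphere d), IsUniformPOVMSample ρ P V →
      ∀ L : Ω → Matrix (Fin d) (Fin d) ℂ,
        (∀ ω, IsLeastSquaresEstimator (fun i => V i ω) (L ω)) →
      ∀ τ δ : ℝ, 0 < τ → τ ≤ 1 → 0 < δ → δ ≤ δ₀ →
        C * ((d : ℝ) / τ ^ 2) * Real.log (1 / δ) ≤ (n : ℝ) →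
        1 - δ ≤ P.real {ω | opNorm (L ω - ρ) ≤ τ})
 := by
  refine ⟨fun d n hn v => ?_, ?_, ?_⟩
  · simp only [isLeastSquaresEstimator_iff hn v]
    exact existsUnique_eq
  · intro d n hn ρ hρ Ω _ P _ V hV L hL τ h0 h1
    simp only [fun ω => (isLeastSquaresEstimator_iff hn _ _).1 (hL ω)]
    exact hV.measure_opNorm_ge_le hn hρ h0 h1
  · intro δ₀ h0 h1
    have hl0 : 0 < Real.log (1 / δ₀) := Real.log_pos (by rw [lt_div_iff₀ h0]; linarith)
    have hl3 : 0 < Real.log 3 := Real.log_pos (by norm_num)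
    have hl2 : 0 < Real.log 2 := Real.log_pos (by norm_num)
    refine ⟨480 * ((2 * Real.log 3 + Real.log 2) / Real.log (1 / δ₀) + 1), by positivity, ?_⟩
    intro d n ρ hρ Ω _ P _ V hV L hL τ δ hτ0 hτ1 hδ hδδ hn
    have hd : (0 : ℝ) < d := Nat.cast_pos.2 (Nat.pos_of_ne_zero hρ.neZero.ne)
    have hl : 0 < Real.log (1 / δ) := Real.log_pos (by rw [lt_div_iff₀ hδ]; linarith)
    have hn0 : 0 < n := by
      rw [← Nat.cast_pos (α := ℝ)]
      refine lt_of_lt_of_le ?_ hn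
      positivity
    simp only [fun ω => (isLeastSquaresEstimator_iff hn0 _ _).1 (hL ω)]
    exact hV.le_measure_opNorm_le hρ h1 hτ0 hτ1 hδ hδδ hn
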